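/- Let $d\ge 1$, let $M_d=M_d(\mathbb C)$, let $\mathcal S_d=\{\rho\in M_d:\rho\ge 0,\ \operatorname{tr}\rho=1\}$, let $\|\cdot\|_1$ be the trace norm on $M_d$, and for linear $L:M_d\to M_d$ put $\|L\|_{1\to1}=\sup_{X\neq0}\|L(X)\|_1/\|X\|_1$. For a positive trace-preserving linear map $T:M_d\to M_d$ let $$\kappa_{\rm tr}(T)=\sup\Big\{\tfrac{\|T(X)\|_1}{\|X\|_1}: X=X^*\in M_d,\ \operatorname{tr}X=0,\ X\ne0\Big\}$$ be its centered trace-Dobrushin coefficient (equal to $0$ when $d=1$). Let $(\Omega,\mathcal F,\mathbb P,\theta)$ be an invertible probability-preserving system (so $\theta$ is a bimeasurable bijection preserving the probability measure $\mathbb P$), and let $\omega\mapsto\Phi_\omega$ be a measurable family of completely positive trace-preserving linear maps on $M_d$. For integers $s<t$ put $$\Phi_{\omega;t:s}=\Phi_{\theta^{t-1}\omega}\circ\Phi_{\theta^{t-2}\omega}\circ\cdots\circ\Phi_{\theta^{s}\omega},\qquad \Phi_{\omega;s:s}=\mathrm{id}.$$ Let $$\lambda_{\rm tr}(\omega)=\lim_{n\to\infty}\tfrac1n\log\kappa_{\rm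 tr}(\Phi_{\omega;n:0})\in[-\infty,0],\qquad \log 0=-\infty,$$ be the trace-Dobrushin Lyapunov exponent; the limit exists for $\mathbb P$-almost every $\omega$ by the subadditive ergodic theorem (to define $\lambda_{\rm tr}$ everywhere, read $\lim$ as $\limsup$). A dynamically stationary random state is a measurable map $\rho:\Omega\to\mathcal S_d$ with $\Phi_\omega(\rho_\omega)=\rho_{\theta\omega}$ for $\mathbb P$-a.e. $\omega$. **Theorem.** Assume that $\lambda_{\rm tr}(\omega)<0$ for $\mathbb P$-a.e. $\omega$. Then there exists a dynamically stationary random state $\rho$, and it is unique: every dynamically stationary random state agrees with $\rho$ $\mathbb P$-almost surely. Let $R_\omega(X)=\operatorname{tr}(X)\,\rho_\omega$. Then there exist a measurable $\theta$-invariant $\beta:\Omega\to(-\infty,0)$, a measurable $\theta$-invariant set $\Omega_*\subseteq\Omega$ with $\mathbb P(\Omega_*)=1$, and finite measurable random variables $C_\beta^+,C_\beta^-:\Omega\to\mathbb R$ such that, for every $\omega\in\Omega_*$ and every $n\ge1$, $$\|\Phi_{\omega;n:0}-R_{\theta^n\omega}\|_{1\to1}\le 4C_\beta^+(\omega)e^{\beta(\omega)n},\qquad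 \|\Phi_{\omega;0:-n}-R_\omega\|_{1\to1}\le 4C_\beta^-(\omega)e^{\beta(\omega)n},$$ and, for every $\sigma\in\mathcal S_d$, $$\|\Phi_{\omega;n:0}(\sigma)-\rho_{\theta^n\omega}\|_1\le 2C_\beta^+(\omega)e^{\beta(\omega)n},\qquad \|\Phi_{\omega;0:-n}(\sigma)-\rho_\omega\|_1\le 2C_\beta^-(\omega)e^{\beta(\omega)n}.$$ -/

import Mathlib

namespace QuantumCocycle

/-- The space `M_d` of complex `d × d` matrices. -/
abbrev Mat (d : ℕ) : Type := Matrix (Fin d) (Fin d) ℂ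

/-- Linear maps `M_d → M_d`. -/
abbrev SuperOp (d : ℕ) : Type := Mat d →ₗ[ℂ] Mat d

section Channels

open scoped ComplexOrder MatrixOrder Matrix.Norms.L2Operator

/-- The trace norm `‖X‖₁ = tr |X|`, where `|X| = (X* X)^(1/2)`. -/
noncomputable def traceNorm {d : ℕ} (X : Mat d) : ℝ :=
  (CFC.abs X).trace.re

/-- `T` is completely positive and trace preserving. Complete positivity is that of Mathlib,
for the C⋆-algebra `M_d` with its order `0 ≤ A ↔ A` positive semidefinite. -/
def IsCPTP {d : ℕ} (T : SuperOp d) : Prop :=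
  (∃ S : CompletelyPositiveMap (Mat d) (Mat d), S.toLinearMap = T) ∧
    ∀ X : Mat d, (T X).trace = X.trace

/-- The state space `S_d = {ρ ∈ M_d : ρ ≥ 0, tr ρ = 1}`. -/
def stateSpace (d : ℕ) : Set (Mat d) :=
  {ρ | ρ.PosSemidef ∧ ρ.trace = 1}

end Channels

/-- The induced norm `‖L‖_{1→1} = sup_{X ≠ 0} ‖L X‖₁ / ‖X‖₁`. -/
noncomputable def oneToOneNorm {d : ℕ} (L : SuperOp d) : ℝ :=
  ⨆ X : {X : Mat d // X ≠ 0}, traceNorm (L X) / traceNorm (X : Mat d)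

/-- The nonzero elements of the centered space `H_0` of self-adjoint trace-zero matrices. -/
def centeredNonzero (d : ℕ) : Set (Mat d) :=
  {X | X.IsHermitian ∧ X.trace = 0 ∧ X ≠ 0}

/-- The centered trace-Dobrushin coefficient
`κ_tr(T) = sup {‖T X‖₁ / ‖X‖₁ : X ∈ H_0, X ≠ 0}`; it is `0` for `d = 1`, where `H_0 = {0}`. -/
noncomputable def kappaTr {d : ℕ} (T : SuperOp d) : ℝ :=
  ⨆ X : centeredNonzero d, traceNorm (T X) / traceNorm (X : Mat d)

/-- The replacement channel `X ↦ tr(X) τ`. -/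
noncomputable def replacement {d : ℕ} (τ : Mat d) : SuperOp d :=
  (Matrix.traceLinearMap (Fin d) ℂ ℂ).smulRight τ

section Cocycle

open MeasureTheory Filter

variable {Ω : Type*} [MeasurableSpace Ω] {d : ℕ}

/-- The integer power `θ^k ω`, `k ∈ ℤ`. -/
def shift (θ : Ω ≃ᵐ Ω) (k : ℤ) (ω : Ω) : Ω :=
  (θ.toEquiv ^ k : Equiv.Perm Ω) ω

/-- The product of the `n` channels starting at time `s`:
`Φ_{θ^{s+n-1} ω} ∘ ⋯ ∘ Φ_{θ^s ω}`, the identity for `n = 0`. -/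
noncomputable def productFrom (θ : Ω ≃ᵐ Ω) (Φ : Ω → SuperOp d) (ω : Ω) (s : ℤ) : ℕ → SuperOp d
  | 0 => LinearMap.id
  | n + 1 => Φ (shift θ (s + n) ω) ∘ₗ productFrom θ Φ ω s n

/-- `Φ_{ω;t:s} = Φ_{θ^{t-1} ω} ∘ ⋯ ∘ Φ_{θ^s ω}` for integers `s ≤ t`. -/
noncomputable def propagator (θ : Ω ≃ᵐ Ω) (Φ : Ω → SuperOp d) (ω : Ω) (t s : ℤ) : SuperOp d :=
  productFrom θ Φ ω s (t - s).toNat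

/-- The sequence `(1/n) log κ_tr(Φ_{ω;n:0})` in `[-∞, ∞]`, with `log 0 = -∞`. -/
noncomputable def logRate (θ : Ω ≃ᵐ Ω) (Φ : Ω → SuperOp d) (ω : Ω) (n : ℕ) : EReal :=
  ENNReal.log (ENNReal.ofReal (kappaTr (propagator θ Φ ω n 0))) / (n : EReal)

/-- The trace-Dobrushin Lyapunov exponent `λ_tr(ω) = lim_n (1/n) log κ_tr(Φ_{ω;n:0})`, made total
by taking the upper limit: it equals the limit wherever the limit exists, hence (by the subadditive
ergodic theorem) almost everywhere for a stationary CPTP cocycle. -/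
noncomputable def lyapunovExponent (θ : Ω ≃ᵐ Ω) (Φ : Ω → SuperOp d) (ω : Ω) : EReal :=
  limsup (logRate θ Φ ω) atTop

theorem lyapunovExponent_eq_of_tendsto (θ : Ω ≃ᵐ Ω) (Φ : Ω → SuperOp d) (ω : Ω) (l : EReal)
    (h : Tendsto (logRate θ Φ ω) atTop (nhds l)) : lyapunovExponent θ Φ ω = l :=
  h.limsup_eq

/-- A measurable family of linear maps on `M_d`: all matrix coefficients are measurable, that is,
`ω ↦ Φ_ω` is Borel measurable into the finite-dimensional space of linear maps on `M_d`. -/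
def MeasurableFamily (Φ : Ω → SuperOp d) : Prop :=
  ∀ (X : Mat d) (i j : Fin d), Measurable fun ω => Φ ω X i j

/-- `ρ : Ω → S_d` is measurable (entrywise, that is, Borel) and `Φ_ω(ρ_ω) = ρ_{θω}` almost
surely. -/
structure IsStationaryState (P : Measure Ω) (θ : Ω ≃ᵐ Ω) (Φ : Ω → SuperOp d)
    (ρ : Ω → Mat d) : Prop where
  mem_stateSpace : ∀ ω, ρ ω ∈ stateSpace d
  measurable : ∀ i j : Fin d, Measurable fun ω => ρ ω i j
  stationary : ∀ᵐ ω ∂P, Φ ω (ρ ω) = ρ (θ ω)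

end Cocycle

end QuantumCocycle

/-! Only one consequence of the negative exponent is used: almost every `ω` has a finite product
with coefficient below `1`. Since coefficients are submultiplicative and at most `1`, lengthening
that product puts `ω` in some `contractingSet θ Φ N`, where a block of fixed length contracts by a
fixed factor.

No ergodic theorem is needed. By `ae_lowerDensity_pos`, almost every point of a set visits it with
positive lower density, under `θ` and under its inverse. The greedy block count
`kappaTr_productFrom_le_exp` turns visits into decay, so both forward and pullback products contract
exponentially, at any rate below `contractionSpeed`. This speed is built from lower densities, which
are invariant at every point, hence so are the rate and the good set.

Contraction of the past makes images of states from time `-n` Cauchy, with a limit independent of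
the initial states (`exists_pullback_limit`). This limit is the stationary state. It is unique
because any stationary state along the orbit is its own pullback. The norm bounds follow because a
channel minus the replacement by the image of `τ` is the channel applied to the centered part `X -
tr(X) τ`. -/

namespace QuantumCocycle

/-! ### Trace norm of Hermitian matrices and states. -/

section TraceNorm

open scoped ComplexOrder MatrixOrder Matrix.Norms.L2Operator

variable {d : ℕ}

theorem trace_re_nonneg {A : Mat d} (hA : 0 ≤ A) : 0 ≤ A.trace.re :=
  (Complex.le_def.1 (Matrix.nonneg_iff_posSemidef.1 hA).trace_nonneg).1

theorem trace_re_mono {A B : Mat d} (h : A ≤ B) : A.trace.re ≤ B.trace.re := by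
  have := trace_re_nonneg (sub_nonneg.2 h)
  rw [Matrix.trace_sub, Complex.sub_re] at this
  linarith

theorem trace_re_mul_nonneg {A B : Mat d} (hA : 0 ≤ A) (hB : 0 ≤ B) : 0 ≤ (A * B).trace.re := by
  obtain ⟨C, rfl⟩ := CStarAlgebra.nonneg_iff_eq_star_mul_self.1 hB
  rw [← mul_assoc, Matrix.trace_mul_comm, ← mul_assoc]
  exact trace_re_nonneg (star_right_conjugate_nonneg hA C)

theorem traceNorm_nonneg (X : Mat d) : 0 ≤ traceNorm X :=
  trace_re_nonneg (CFC.abs_nonneg X)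

theorem traceNorm_of_nonneg {X : Mat d} (hX : 0 ≤ X) : traceNorm X = X.trace.re := by
  rw [traceNorm, CFC.abs_of_nonneg X hX]

theorem traceNorm_zero : traceNorm (0 : Mat d) = 0 := by
  simp [traceNorm]

theorem continuous_traceNorm : Continuous (traceNorm : Mat d → ℝ) := by
  have : Continuous fun X : Mat d => (Matrix.traceLinearMap (Fin d) ℂ ℂ) X :=
    LinearMap.continuous_of_finiteDimensional _
  exact Complex.continuous_re.comp (this.comp CFC.continuous_abs)

theorem norm_le_trace_re {A : Mat d} (hA : 0 ≤ A) : ‖A‖ ≤ A.trace.re := by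
  have hA' := Matrix.nonneg_iff_posSemidef.1 hA
  rw [CStarAlgebra.norm_le_iff_le_algebraMap A (trace_re_nonneg hA),
    le_algebraMap_iff_spectrum_le (ha := hA'.1.isSelfAdjoint)]
  intro x hx
  rw [hA'.1.spectrum_real_eq_range_eigenvalues] at hx
  obtain ⟨i, rfl⟩ := hx
  have h : A.trace.re = ∑ j, hA'.1.eigenvalues j := by
    rw [hA'.1.trace_eq_sum_eigenvalues]; simp
  rw [h]
  exact Finset.single_le_sum (fun j _ => hA'.eigenvalues_nonneg j) (Finset.mem_univ i)

theorem trace_re_le_norm {A : Mat d} (hA : 0 ≤ A) : A.trace.re ≤ d * ‖A‖ := by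
  have h : A ≤ algebraMap ℝ (Mat d) ‖A‖ :=
    IsSelfAdjoint.le_algebraMap_norm_self (IsSelfAdjoint.of_nonneg hA)
  refine (trace_re_mono h).trans (le_of_eq ?_)
  simp [Algebra.algebraMap_eq_smul_one, mul_comm]

theorem norm_le_traceNorm (X : Mat d) : ‖X‖ ≤ traceNorm X := by
  rw [← CFC.norm_abs]
  exact norm_le_trace_re (CFC.abs_nonneg X)

theorem traceNorm_le_norm (X : Mat d) : traceNorm X ≤ d * ‖X‖ := by
  rw [← CFC.norm_abs (a := X)]
  exact trace_re_le_norm (CFC.abs_nonneg X)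

theorem traceNorm_pos {X : Mat d} (hX : X ≠ 0) : 0 < traceNorm X :=
  (norm_pos_iff.2 hX).trans_le (norm_le_traceNorm X)

theorem traceNorm_eq_posPart_add_negPart {X : Mat d} (hX : X.IsHermitian) :
    traceNorm X = (X⁺).trace.re + (X⁻).trace.re := by
  rw [traceNorm, ← CFC.posPart_add_negPart X hX.isSelfAdjoint, Matrix.trace_add, Complex.add_re]

/-- The absolute value of a Hermitian matrix is its product with its sign. -/
theorem exists_sign_mul {X : Mat d} (hX : X.IsHermitian) :
    ∃ S : Mat d, S ≤ 1 ∧ -1 ≤ S ∧ CFC.abs X = S * X := by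
  -- The spectrum is finite, so the functional calculus applies even to the discontinuous sign
  -- function.
  have hc : ∀ f : ℝ → ℝ, ContinuousOn f (spectrum ℝ X) := fun f =>
    X.finite_real_spectrum.continuousOn f
  have hX' : IsSelfAdjoint X := hX.isSelfAdjoint
  refine ⟨cfc Real.sign X, cfc_le_one _ _ fun x _ => ?_, ?_, ?_⟩
  · rcases Real.sign_apply_eq x with h | h | h <;> rw [h] <;> norm_num
  · have := algebraMap_le_cfc Real.sign (-1) X (fun x _ => by
      rcases Real.sign_apply_eq x with h | h | h <;> rw [h] <;> norm_num) (hc _) hX'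
    simpa using this
  · rw [CFC.abs_eq_cfc_norm X hX']
    nth_rewrite 3 [← cfc_id' ℝ X]
    rw [← cfc_mul _ _ _ (hc _) (hc _)]
    congr 1
    funext x
    rcases lt_trichotomy x 0 with h | h | h
    · rw [Real.sign_of_neg h, Real.norm_of_nonpos h.le]; ring
    · simp [h]
    · rw [Real.sign_of_pos h, Real.norm_of_nonneg h.le]; ring

/-- With `S` the sign of `A - B`, the trace norm is `tr(SA) - tr(SB)`, and `-1 ≤ S ≤ 1` bounds each
term. The Hermitian triangle inequality and the contractivity of positive trace-preserving maps both
reduce to this. -/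
theorem traceNorm_sub_le_trace {A B : Mat d} (hA : 0 ≤ A) (hB : 0 ≤ B) :
    traceNorm (A - B) ≤ A.trace.re + B.trace.re := by
  have hX : (A - B).IsHermitian :=
    (Matrix.nonneg_iff_posSemidef.1 hA).1.sub (Matrix.nonneg_iff_posSemidef.1 hB).1
  obtain ⟨S, h1, h2, h3⟩ := exists_sign_mul hX
  have hSA := trace_re_mul_nonneg (sub_nonneg.2 h1) hA
  have hSB := trace_re_mul_nonneg (sub_nonneg.2 h2) hB
  rw [traceNorm, h3]
  simp only [sub_mul, mul_sub, Matrix.trace_sub, Complex.sub_re, one_mul, neg_mul,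
    Matrix.trace_neg, Complex.neg_re] at hSA hSB ⊢
  linarith

theorem traceNorm_add_le {X Y : Mat d} (hX : X.IsHermitian) (hY : Y.IsHermitian) :
    traceNorm (X + Y) ≤ traceNorm X + traceNorm Y := by
  have h : X + Y = (X⁺ + Y⁺) - (X⁻ + Y⁻) := by
    conv_lhs => rw [← CFC.posPart_sub_negPart X hX.isSelfAdjoint,
      ← CFC.posPart_sub_negPart Y hY.isSelfAdjoint]
    abel
  rw [h, traceNorm_eq_posPart_add_negPart hX, traceNorm_eq_posPart_add_negPart hY]
  refine (traceNorm_sub_le_trace (add_nonneg (CFC.posPart_nonneg X) (CFC.posPart_nonneg Y))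
    (add_nonneg (CFC.negPart_nonneg X) (CFC.negPart_nonneg Y))).trans (le_of_eq ?_)
  simp only [Matrix.trace_add, Complex.add_re]
  ring

theorem abs_trace_re_le_traceNorm {X : Mat d} (hX : X.IsHermitian) :
    |X.trace.re| ≤ traceNorm X := by
  have h := congrArg (fun Y : Mat d => Y.trace.re) (CFC.posPart_sub_negPart X hX.isSelfAdjoint)
  simp only [Matrix.trace_sub, Complex.sub_re] at h
  have h1 := trace_re_nonneg (CFC.posPart_nonneg X)
  have h2 := trace_re_nonneg (CFC.negPart_nonneg X)
  rw [traceNorm_eq_posPart_add_negPart hX, abs_le]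
  constructor <;> linarith

theorem traceNorm_smul_real (r : ℝ) (X : Mat d) :
    traceNorm ((r : ℂ) • X) = |r| * traceNorm X := by
  rw [traceNorm, CFC.abs_smul, traceNorm]
  simp

theorem trace_re_eq_one_of_mem {τ : Mat d} (h : τ ∈ stateSpace d) : τ.trace.re = 1 := by
  rw [h.2]; rfl

theorem traceNorm_sub_le_two {σ τ : Mat d} (hσ : σ ∈ stateSpace d) (hτ : τ ∈ stateSpace d) :
    traceNorm (σ - τ) ≤ 2 := by
  refine (traceNorm_sub_le_trace (Matrix.nonneg_iff_posSemidef.2 hσ.1)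
    (Matrix.nonneg_iff_posSemidef.2 hτ.1)).trans (le_of_eq ?_)
  rw [trace_re_eq_one_of_mem hσ, trace_re_eq_one_of_mem hτ]
  norm_num

/-- The factor `2` is the triangle inequality together with `|tr X| ≤ ‖X‖₁` and `‖τ‖₁ = 1`. -/
theorem traceNorm_sub_trace_smul_le {X τ : Mat d} (hX : X.IsHermitian) (hτ : τ ∈ stateSpace d) :
    traceNorm (X - X.trace • τ) ≤ 2 * traceNorm X := by
  have ht : X.trace = (X.trace.re : ℂ) :=
    (Complex.conj_eq_iff_re.1 (by rw [← Complex.star_def, ← Matrix.trace_conjTranspose, hX.eq])).symm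
  have h1 : X - X.trace • τ = X + ((-X.trace.re : ℝ) : ℂ) • τ := by
    rw [ht]; simp [sub_eq_add_neg]
  have h2 : (((-X.trace.re : ℝ) : ℂ) • τ).IsHermitian := by
    rw [Matrix.IsHermitian, Matrix.conjTranspose_smul, hτ.1.1.eq, Complex.star_def,
      Complex.conj_ofReal]
  rw [h1]
  refine (traceNorm_add_le hX h2).trans ?_
  rw [traceNorm_smul_real, traceNorm_of_nonneg (Matrix.nonneg_iff_posSemidef.2 hτ.1),
    trace_re_eq_one_of_mem hτ, abs_neg]
  linarith [abs_trace_re_le_traceNorm hX]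

theorem isClosed_stateSpace : IsClosed (stateSpace d) := by
  have h1 : IsClosed {A : Mat d | 0 ≤ A} := isClosed_Ici
  have h2 : Continuous fun X : Mat d => (Matrix.traceLinearMap (Fin d) ℂ ℂ) X :=
    LinearMap.continuous_of_finiteDimensional _
  have h3 : IsClosed {A : Mat d | A.trace = 1} := isClosed_singleton.preimage h2
  have : stateSpace d = {A : Mat d | 0 ≤ A} ∩ {A : Mat d | A.trace = 1} := by
    ext A; simp [stateSpace, Matrix.nonneg_iff_posSemidef]
  rw [this]
  exact h1.inter h3

end TraceNorm

/-! ### Positive trace-preserving maps and the Dobrushin coefficient. -/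

section CPTP

open scoped ComplexOrder MatrixOrder Matrix.Norms.L2Operator

variable {d : ℕ}

/-- `T` is positive and trace preserving. -/
structure IsPTP (T : SuperOp d) : Prop where
  nonneg : ∀ X : Mat d, 0 ≤ X → 0 ≤ T X
  trace : ∀ X : Mat d, (T X).trace = X.trace

theorem IsCPTP.isPTP {T : SuperOp d} (hT : IsCPTP T) : IsPTP T := by
  obtain ⟨⟨S, rfl⟩, h⟩ := hT
  exact ⟨fun _ hX => map_nonneg S hX, h⟩

theorem IsPTP.id : IsPTP (LinearMap.id : SuperOp d) := ⟨fun _ h => h, fun _ => rfl⟩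

theorem IsPTP.comp {S T : SuperOp d} (hS : IsPTP S) (hT : IsPTP T) : IsPTP (S ∘ₗ T) :=
  ⟨fun _ hX => hS.nonneg _ (hT.nonneg _ hX), fun _ => (hS.trace _).trans (hT.trace _)⟩

theorem IsPTP.map_stateSpace {T : SuperOp d} (hT : IsPTP T) {σ : Mat d} (hσ : σ ∈ stateSpace d) :
    T σ ∈ stateSpace d :=
  ⟨Matrix.nonneg_iff_posSemidef.1 (hT.nonneg _ (Matrix.nonneg_iff_posSemidef.2 hσ.1)),
    (hT.trace _).trans hσ.2⟩

theorem IsPTP.isHermitian {T : SuperOp d} (hT : IsPTP T) {X : Mat d} (hX : X.IsHermitian) :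
    (T X).IsHermitian := by
  rw [← CFC.posPart_sub_negPart X hX.isSelfAdjoint, map_sub]
  exact (Matrix.nonneg_iff_posSemidef.1 (hT.nonneg _ (CFC.posPart_nonneg X))).1.sub
    (Matrix.nonneg_iff_posSemidef.1 (hT.nonneg _ (CFC.negPart_nonneg X))).1

/-- The images of the positive and negative parts are nonnegative with unchanged traces, and these
traces add up to `‖X‖₁`. -/
theorem IsPTP.traceNorm_le {T : SuperOp d} (hT : IsPTP T) {X : Mat d} (hX : X.IsHermitian) :
    traceNorm (T X) ≤ traceNorm X := by
  rw [traceNorm_eq_posPart_add_negPart hX]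
  nth_rewrite 1 [← CFC.posPart_sub_negPart X hX.isSelfAdjoint]
  rw [map_sub]
  refine (traceNorm_sub_le_trace (hT.nonneg _ (CFC.posPart_nonneg X))
    (hT.nonneg _ (CFC.negPart_nonneg X))).trans (le_of_eq ?_)
  rw [hT.trace, hT.trace]

theorem IsPTP.bddAbove {T : SuperOp d} (hT : IsPTP T) :
    BddAbove (Set.range fun X : centeredNonzero d => traceNorm (T X) / traceNorm (X : Mat d)) :=
  ⟨1, by
    rintro _ ⟨X, rfl⟩
    exact div_le_one_of_le₀ (hT.traceNorm_le X.2.1) (traceNorm_nonneg _)⟩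

theorem kappaTr_nonneg (T : SuperOp d) : 0 ≤ kappaTr T :=
  Real.iSup_nonneg fun _ => div_nonneg (traceNorm_nonneg _) (traceNorm_nonneg _)

theorem IsPTP.kappaTr_le_one {T : SuperOp d} (hT : IsPTP T) : kappaTr T ≤ 1 :=
  Real.iSup_le (fun X => div_le_one_of_le₀ (hT.traceNorm_le X.2.1) (traceNorm_nonneg _))
    zero_le_one

theorem IsPTP.traceNorm_le_kappaTr {T : SuperOp d} (hT : IsPTP T) {X : Mat d}
    (hX : X.IsHermitian) (hX0 : X.trace = 0) : traceNorm (T X) ≤ kappaTr T * traceNorm X := by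
  by_cases h : X = 0
  · simp [h, traceNorm_zero]
  · rw [← div_le_iff₀ (traceNorm_pos h)]
    exact le_ciSup hT.bddAbove ⟨X, hX, hX0, h⟩

theorem IsPTP.kappaTr_comp_le {S T : SuperOp d} (hS : IsPTP S) (hT : IsPTP T) :
    kappaTr (S ∘ₗ T) ≤ kappaTr S * kappaTr T := by
  refine Real.iSup_le (fun X => ?_) (mul_nonneg (kappaTr_nonneg S) (kappaTr_nonneg T))
  rw [div_le_iff₀ (traceNorm_pos X.2.2.2), mul_assoc]
  refine (hS.traceNorm_le_kappaTr (hT.isHermitian X.2.1) ((hT.trace _).trans X.2.2.1)).trans ?_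
  exact mul_le_mul_of_nonneg_left (hT.traceNorm_le_kappaTr X.2.1 X.2.2.1) (kappaTr_nonneg S)

theorem IsPTP.traceNorm_sub_state_le {T : SuperOp d} (hT : IsPTP T) {σ τ : Mat d}
    (hσ : σ ∈ stateSpace d) (hτ : τ ∈ stateSpace d) :
    traceNorm (T σ - T τ) ≤ 2 * kappaTr T := by
  rw [← map_sub, mul_comm]
  refine (hT.traceNorm_le_kappaTr (hσ.1.1.sub hτ.1.1) ?_).trans
    (mul_le_mul_of_nonneg_left (traceNorm_sub_le_two hσ hτ) (kappaTr_nonneg T))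
  rw [Matrix.trace_sub, hσ.2, hτ.2, sub_self]

theorem IsPTP.traceNorm_sub_replacement_le {T : SuperOp d} (hT : IsPTP T) {X τ : Mat d}
    (hX : X.IsHermitian) (hτ : τ ∈ stateSpace d) :
    traceNorm ((T - replacement (T τ)) X) ≤ 2 * kappaTr T * traceNorm X := by
  have h : (T - replacement (T τ)) X = T (X - X.trace • τ) := by
    simp [replacement]
  have ht : X.trace = (X.trace.re : ℂ) :=
    (Complex.conj_eq_iff_re.1 (by rw [← Complex.star_def, ← Matrix.trace_conjTranspose, hX.eq])).symm
  have h2 : (X - X.trace • τ).IsHermitian := by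
    refine hX.sub ?_
    rw [ht, Matrix.IsHermitian, Matrix.conjTranspose_smul, hτ.1.1.eq, Complex.star_def,
      Complex.conj_ofReal]
  rw [h]
  refine (hT.traceNorm_le_kappaTr h2 ?_).trans ?_
  · rw [Matrix.trace_sub, Matrix.trace_smul, hτ.2]; simp
  · have := mul_le_mul_of_nonneg_left (traceNorm_sub_trace_smul_le hX hτ) (kappaTr_nonneg T)
    linarith

/-- The coefficient controls Hermitian inputs only, so `X` is split into real and imaginary parts.
Passing to the operator norm and back costs a factor `d` on the input and another on the output; the
`d ^ 2` is later absorbed into the random constants. -/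
theorem IsPTP.oneToOneNorm_sub_replacement_le {T : SuperOp d} (hT : IsPTP T) {τ : Mat d}
    (hτ : τ ∈ stateSpace d) :
    oneToOneNorm (T - replacement (T τ)) ≤ 4 * (d ^ 2 * kappaTr T) := by
  have hk := kappaTr_nonneg T
  refine Real.iSup_le (fun X => ?_) (by positivity)
  rw [div_le_iff₀ (traceNorm_pos X.2)]
  obtain ⟨X, hX⟩ := X
  simp only
  set L := T - replacement (T τ)
  have key : ∀ Y : Mat d, Y.IsHermitian → ‖Y‖ ≤ ‖X‖ →
      ‖L Y‖ ≤ 2 * kappaTr T * (d * traceNorm X) := fun Y hY hYX => by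
    refine (norm_le_traceNorm _).trans ((hT.traceNorm_sub_replacement_le hY hτ).trans ?_)
    refine mul_le_mul_of_nonneg_left ?_ (by positivity)
    refine (traceNorm_le_norm Y).trans (mul_le_mul_of_nonneg_left ?_ (Nat.cast_nonneg d))
    exact hYX.trans (norm_le_traceNorm X)
  have h1 := key (realPart X : Mat d) (realPart X).2 (realPart.norm_le X)
  have h2 := key (imaginaryPart X : Mat d) (imaginaryPart X).2 (imaginaryPart.norm_le X)
  have h3 : L X = L (realPart X : Mat d) + Complex.I • L (imaginaryPart X : Mat d) := by
    rw [← map_smul, ← map_add, realPart_add_I_smul_imaginaryPart]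
  have h4 : ‖L X‖ ≤ ‖L (realPart X : Mat d)‖ + ‖L (imaginaryPart X : Mat d)‖ := by
    rw [h3]
    refine (norm_add_le _ _).trans (le_of_eq ?_)
    rw [norm_smul, Complex.norm_I, one_mul]
  calc traceNorm (L X) ≤ d * ‖L X‖ := traceNorm_le_norm _
    _ ≤ d * (2 * kappaTr T * (d * traceNorm X) + 2 * kappaTr T * (d * traceNorm X)) :=
        mul_le_mul_of_nonneg_left (by linarith) (Nat.cast_nonneg d)
    _ = 4 * (d ^ 2 * kappaTr T) * traceNorm X := by ring

end CPTP

end QuantumCocycle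

/-! ### Recurrence with positive lower density. -/

section LowerDensity

open MeasureTheory Filter Topology

variable {Ω : Type*}

/-- The lower density of the set of times at which the forward orbit of a point visits `A`. -/
noncomputable def lowerDensity (f : Ω → Ω) (A : Set Ω) (ω : Ω) : ℝ :=
  liminf (fun n => birkhoffAverage ℝ f (A.indicator 1) n ω) atTop

theorem birkhoffAverage_indicator_nonneg (f : Ω → Ω) (A : Set Ω) (n : ℕ) (ω : Ω) :
    0 ≤ birkhoffAverage ℝ f (A.indicator (1 : Ω → ℝ)) n ω :=
  mul_nonneg (by positivity)
    (Finset.sum_nonneg fun _ _ => Set.indicator_nonneg (fun _ _ => zero_le_one) _)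

theorem birkhoffSum_indicator_le (f : Ω → Ω) (A : Set Ω) (n : ℕ) (ω : Ω) :
    birkhoffSum f (A.indicator (1 : Ω → ℝ)) n ω ≤ n := by
  refine (Finset.sum_le_card_nsmul _ _ 1 fun _ _ => ?_).trans (by simp)
  exact Set.indicator_apply_le' (fun _ => le_rfl) fun _ => zero_le_one

theorem birkhoffAverage_indicator_le_one (f : Ω → Ω) (A : Set Ω) (n : ℕ) (ω : Ω) :
    birkhoffAverage ℝ f (A.indicator (1 : Ω → ℝ)) n ω ≤ 1 := by
  rw [birkhoffAverage, smul_eq_mul]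
  exact inv_mul_le_one_of_le₀ (birkhoffSum_indicator_le f A n ω) (Nat.cast_nonneg n)

theorem isBoundedUnder_ge_birkhoffAverage_indicator (f : Ω → Ω) (A : Set Ω) (ω : Ω) :
    IsBoundedUnder (· ≥ ·) atTop
      fun n => birkhoffAverage ℝ f (A.indicator (1 : Ω → ℝ)) n ω :=
  isBoundedUnder_of ⟨0, fun n => birkhoffAverage_indicator_nonneg f A n ω⟩

theorem isCoboundedUnder_ge_birkhoffAverage_indicator (f : Ω → Ω) (A : Set Ω) (ω : Ω) :
    IsCoboundedUnder (· ≥ ·) atTop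
      fun n => birkhoffAverage ℝ f (A.indicator (1 : Ω → ℝ)) n ω :=
  (isBoundedUnder_of (r := (· ≤ ·))
    ⟨1, fun n => birkhoffAverage_indicator_le_one f A n ω⟩).isCoboundedUnder_ge

theorem lowerDensity_nonneg (f : Ω → Ω) (A : Set Ω) (ω : Ω) : 0 ≤ lowerDensity f A ω :=
  le_liminf_of_le (isCoboundedUnder_ge_birkhoffAverage_indicator f A ω)
    (Eventually.of_forall fun n => birkhoffAverage_indicator_nonneg f A n ω)

theorem lowerDensity_le_one (f : Ω → Ω) (A : Set Ω) (ω : Ω) : lowerDensity f A ω ≤ 1 :=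
  liminf_le_of_frequently_le
    (Frequently.of_forall fun n => birkhoffAverage_indicator_le_one f A n ω)
    (isBoundedUnder_ge_birkhoffAverage_indicator f A ω)

theorem liminf_le_liminf_of_tendsto_sub {u v : ℕ → ℝ} (hu : IsBoundedUnder (· ≥ ·) atTop u)
    (hv : IsCoboundedUnder (· ≥ ·) atTop v) (h : Tendsto (fun n => u n - v n) atTop (𝓝 0)) :
    liminf u atTop ≤ liminf v atTop := by
  refine le_of_forall_lt fun c hc => ?_
  obtain ⟨c₁, hc₁, hc₁'⟩ := exists_between hc
  obtain ⟨c₂, hc₂, hc₂'⟩ := exists_between hc₁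
  refine hc₂.trans_le (le_liminf_of_le hv ?_)
  filter_upwards [eventually_lt_of_lt_liminf hc₁' hu,
    h.eventually (gt_mem_nhds (sub_pos.2 hc₂'))] with n h1 h2
  linarith

/-- Shifting the starting point changes the averages by `O(1/n)`. This holds at every point, with no
exceptional null set. -/
theorem lowerDensity_apply (f : Ω → Ω) (A : Set Ω) (ω : Ω) :
    lowerDensity f A (f ω) = lowerDensity f A ω := by
  have h : Tendsto (fun n => birkhoffAverage ℝ f (A.indicator (1 : Ω → ℝ)) n (f ω) -
      birkhoffAverage ℝ f (A.indicator (1 : Ω → ℝ)) n ω) atTop (𝓝 0) := by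
    refine tendsto_birkhoffAverage_apply_sub_birkhoffAverage ℝ ?_
    refine (Metric.isBounded_Icc (0 : ℝ) 1).subset ?_
    rintro _ ⟨n, rfl⟩
    exact ⟨Set.indicator_nonneg (fun _ _ => zero_le_one) _,
      Set.indicator_apply_le' (fun _ => le_rfl) fun _ => zero_le_one⟩
  refine le_antisymm ?_ ?_
  · exact liminf_le_liminf_of_tendsto_sub (isBoundedUnder_ge_birkhoffAverage_indicator f A _)
      (isCoboundedUnder_ge_birkhoffAverage_indicator f A _) h
  · refine liminf_le_liminf_of_tendsto_sub (isBoundedUnder_ge_birkhoffAverage_indicator f A _)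
      (isCoboundedUnder_ge_birkhoffAverage_indicator f A _) ?_
    simpa using h.neg

theorem eventually_lt_birkhoffSum_of_lt_lowerDensity {f : Ω → Ω} {A : Set Ω} {ω : Ω} {c : ℝ}
    (h : c < lowerDensity f A ω) :
    ∀ᶠ n : ℕ in atTop, c * n ≤ birkhoffSum f (A.indicator (1 : Ω → ℝ)) n ω := by
  filter_upwards [eventually_lt_of_lt_liminf h (isBoundedUnder_ge_birkhoffAverage_indicator f A ω),
    eventually_gt_atTop 0] with n h1 h2
  rw [birkhoffAverage, smul_eq_mul, lt_inv_mul_iff₀ (by positivity)] at h1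
  linarith

/-- A sequence bounded by `1` all of whose nonzero terms start a block of length at most `M` with
average at most `ε` has long averages at most about `ε`. -/
theorem sum_range_le_of_short_blocks {a : ℕ → ℝ} {M : ℕ} {ε : ℝ} (hε : 0 ≤ ε)
    (ha : ∀ k, a k ≤ 1)
    (h : ∀ k, a k = 0 ∨ ∃ m, 1 ≤ m ∧ m ≤ M ∧ ∑ i ∈ Finset.range m, a (k + i) ≤ ε * m) (L : ℕ) :
    ∀ k, ∑ i ∈ Finset.range L, a (k + i) ≤ ε * L + M := by
  induction L using Nat.strong_induction_on with
  | _ L ih =>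
    intro k
    -- The additive `M` pays for the final stretch, which may be too short to hold a complete block.
    by_cases hL : L ≤ M
    · have h1 : ∑ i ∈ Finset.range L, a (k + i) ≤ L :=
        (Finset.sum_le_card_nsmul _ _ 1 fun _ _ => ha _).trans (by simp)
      have h2 : (L : ℝ) ≤ M := by exact_mod_cast hL
      have h3 : 0 ≤ ε * L := by positivity
      linarith
    have split : ∀ m, m ≤ L → ∑ i ∈ Finset.range L, a (k + i) =
        ∑ i ∈ Finset.range m, a (k + i) + ∑ i ∈ Finset.range (L - m), a (k + m + i) := by
      intro m hm
      conv_lhs => rw [← Nat.add_sub_cancel' hm, Finset.sum_range_add]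
      simp only [add_assoc]
    rcases h k with h0 | ⟨m, hm1, hmM, hm⟩
    · rw [split 1 (by omega), Finset.sum_range_one, add_zero, h0, zero_add]
      refine (ih (L - 1) (by omega) _).trans ?_
      have : ((L - 1 : ℕ) : ℝ) ≤ L := by exact_mod_cast Nat.sub_le L 1
      nlinarith
    · rw [split m (by omega)]
      have h1 := ih (L - m) (by omega) (k + m)
      rw [Nat.cast_sub (by omega)] at h1
      linarith

variable [MeasurableSpace Ω]

theorem measurable_birkhoffAverage_indicator {f : Ω → Ω} (hf : Measurable f) {A : Set Ω}
    (hA : MeasurableSet A) (n : ℕ) :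
    Measurable (birkhoffAverage ℝ f (A.indicator (1 : Ω → ℝ)) n) := by
  have h : Measurable fun ω => ∑ k ∈ Finset.range n, A.indicator (1 : Ω → ℝ) (f^[k] ω) :=
    Finset.measurable_sum _ fun k _ => (measurable_one.indicator hA).comp (hf.iterate k)
  exact h.const_smul (n : ℝ)⁻¹

theorem measurable_lowerDensity {f : Ω → Ω} (hf : Measurable f) {A : Set Ω}
    (hA : MeasurableSet A) : Measurable (lowerDensity f A) :=
  Measurable.liminf fun n => measurable_birkhoffAverage_indicator hf hA n

theorem integral_birkhoffSum_indicator {P : Measure Ω} [IsFiniteMeasure P] {f : Ω → Ω}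
    (hf : MeasurePreserving f P P) {A : Set Ω} (hA : MeasurableSet A) (n : ℕ) :
    Integrable (birkhoffSum f (A.indicator (1 : Ω → ℝ)) n) P ∧
      ∫ ω, birkhoffSum f (A.indicator (1 : Ω → ℝ)) n ω ∂P = n * P.real A := by
  have h : ∀ k, (fun ω => A.indicator (1 : Ω → ℝ) (f^[k] ω)) = (f^[k] ⁻¹' A).indicator 1 :=
    fun _ => rfl
  have hm : ∀ k, MeasurableSet (f^[k] ⁻¹' A) := fun k => (hf.iterate k).measurable hA
  have hi : ∀ k, Integrable (fun ω => A.indicator (1 : Ω → ℝ) (f^[k] ω)) P := fun k => by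
    rw [h]
    exact (integrable_const (1 : ℝ)).indicator (hm k)
  refine ⟨integrable_finsetSum _ fun k _ => hi k, ?_⟩
  simp only [birkhoffSum]
  rw [integral_finsetSum _ fun k _ => hi k]
  simp only [h, integral_indicator_one (hm _), measureReal_def,
    (hf.iterate _).measure_preimage hA.nullMeasurableSet]
  simp

/-- Almost every point of `A` returns to `A` with positive lower density. -/
theorem ae_lowerDensity_pos {P : Measure Ω} [IsProbabilityMeasure P] {f : Ω → Ω}
    (hf : MeasurePreserving f P P) {A : Set Ω} (hA : MeasurableSet A) :
    ∀ᵐ ω ∂P, ω ∈ A → 0 < lowerDensity f A ω := by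
  set S : Set Ω := A ∩ {ω | lowerDensity f A ω ≤ 0} with hS
  have hSm : MeasurableSet S :=
    hA.inter (measurableSet_le (measurable_lowerDensity hf.measurable hA) measurable_const)
  suffices h : P S = 0 by
    filter_upwards [measure_eq_zero_iff_ae_notMem.1 h] with ω hω hωA
    by_contra hneg
    exact hω ⟨hωA, not_lt.1 hneg⟩
  refine le_antisymm (ENNReal.le_of_forall_pos_le_add fun ε hε _ => ?_) zero_le
  rw [zero_add]
  -- Points of `S` whose visits to `A` have average at most `ε` over some window of length at most
  -- `M`. They exhaust `S`, and bounding the window makes the covering argument uniform.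
  set T : ℕ → Set Ω := fun M => S ∩ ⋃ m ∈ Finset.Icc 1 M,
    {ω | birkhoffAverage ℝ f (A.indicator (1 : Ω → ℝ)) m ω ≤ ε}
  have hTm : ∀ M, MeasurableSet (T M) := fun M =>
    hSm.inter (Finset.measurableSet_biUnion _ fun m _ =>
      measurableSet_le (measurable_birkhoffAverage_indicator hf.measurable hA m) measurable_const)
  have hTmono : Monotone T := fun M N hMN =>
    Set.inter_subset_inter_right _ (Set.biUnion_subset_biUnion_left fun m hm =>
      Finset.Icc_subset_Icc_right hMN hm)
  have hTS : ⋃ M, T M = S := by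
    refine subset_antisymm (Set.iUnion_subset fun M => Set.inter_subset_left) fun ω hω => ?_
    have hlt : lowerDensity f A ω < ε := hω.2.trans_lt hε
    obtain ⟨m, hm, hm1⟩ := ((frequently_lt_of_liminf_lt
      (isCoboundedUnder_ge_birkhoffAverage_indicator f A ω) hlt).and_eventually
        (eventually_ge_atTop 1)).exists
    exact Set.mem_iUnion.2 ⟨m, hω, Set.mem_biUnion (Finset.mem_coe.2 (Finset.mem_Icc.2 ⟨hm1, le_rfl⟩))
      hm.le⟩
  have hTε : ∀ M, P.real (T M) ≤ ε := by
    intro M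
    have hsum : ∀ (L : ℕ) (ω : Ω),
        birkhoffSum f ((T M).indicator (1 : Ω → ℝ)) L ω ≤ ε * L + M := by
      intro L ω
      have := sum_range_le_of_short_blocks (a := fun k => (T M).indicator (1 : Ω → ℝ) (f^[k] ω))
        (M := M) (ε := ε) ε.2
        (fun k => Set.indicator_apply_le' (fun _ => le_rfl) fun _ => zero_le_one)
        (fun k => ?_) L 0
      · simpa [birkhoffSum] using this
      by_cases hk : f^[k] ω ∈ T M
      · right
        obtain ⟨m, hm, hm'⟩ := Set.mem_iUnion₂.1 hk.2
        rw [Finset.mem_Icc] at hm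
        refine ⟨m, hm.1, hm.2, ?_⟩
        have hm0 : (0 : ℝ) < m := by exact_mod_cast hm.1
        have h1 : birkhoffSum f (A.indicator (1 : Ω → ℝ)) m (f^[k] ω) ≤ ε * m := by
          have h2 : birkhoffAverage ℝ f (A.indicator (1 : Ω → ℝ)) m (f^[k] ω) ≤ ε := hm'
          rw [birkhoffAverage, smul_eq_mul, inv_mul_le_iff₀ hm0] at h2
          linarith
        refine le_trans (Finset.sum_le_sum fun i _ => ?_) h1
        -- Since `T M ⊆ A`, a window sparse for `A` is sparse for `T M`.
        rw [add_comm k i, Function.iterate_add_apply]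
        exact Set.indicator_le_indicator_of_subset (fun x hx => hx.1.1)
          (fun _ => zero_le_one) _
      · left
        exact Set.indicator_of_notMem hk _
    -- Integrating the pointwise count uses invariance of `P`; dividing by a large `L` then removes
    -- `M`.
    have hbound : ∀ L : ℕ, L * P.real (T M) ≤ (ε * L + M) * P.real Set.univ := by
      intro L
      obtain ⟨h1, h2⟩ := integral_birkhoffSum_indicator hf (hTm M) L
      rw [← h2]
      refine (integral_mono h1 (integrable_const _) (hsum L)).trans (le_of_eq ?_)
      rw [integral_const, smul_eq_mul, mul_comm]
    by_contra! hlt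
    obtain ⟨L, hL⟩ := exists_nat_gt (M / (P.real (T M) - ε))
    rw [div_lt_iff₀ (sub_pos.2 hlt)] at hL
    have := hbound L
    rw [probReal_univ, mul_one] at this
    linarith
  rw [← hTS, hTmono.measure_iUnion]
  refine iSup_le fun M => ?_
  rw [← ENNReal.ofReal_coe_nnreal]
  exact (ENNReal.le_ofReal_iff_toReal_le (measure_ne_top _ _) ε.2).2 (hTε M)

end LowerDensity

/-! ### Exponential contraction of the cocycle in both time directions. -/

namespace QuantumCocycle

section Cocycle

open MeasureTheory Filter Topology

variable {Ω : Type*} [MeasurableSpace Ω] {d : ℕ}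

theorem shift_zero (θ : Ω ≃ᵐ Ω) (ω : Ω) : shift θ 0 ω = ω := rfl

theorem shift_add (θ : Ω ≃ᵐ Ω) (k l : ℤ) (ω : Ω) :
    shift θ (k + l) ω = shift θ k (shift θ l ω) := by
  simp [shift, zpow_add]

theorem shift_one (θ : Ω ≃ᵐ Ω) (ω : Ω) : shift θ 1 ω = θ ω := by
  simp [shift]

theorem shift_natCast (θ : Ω ≃ᵐ Ω) (n : ℕ) (ω : Ω) : shift θ n ω = θ^[n] ω := by
  induction n with
  | zero => rfl
  | succ n ih =>
    rw [Function.iterate_succ_apply', ← ih, ← shift_one θ, ← shift_add]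
    congr 1
    push_cast
    ring

theorem shift_neg_natCast (θ : Ω ≃ᵐ Ω) (n : ℕ) (ω : Ω) : shift θ (-n) ω = θ.symm^[n] ω := by
  induction n with
  | zero => rfl
  | succ n ih =>
    rw [Function.iterate_succ_apply', ← ih, ← θ.symm_apply_apply (shift θ (-↑(n + 1)) ω),
      ← shift_one θ, ← shift_add]
    congr 2
    push_cast
    ring

theorem measurePreserving_shift {P : Measure Ω} {θ : Ω ≃ᵐ Ω} (hθ : MeasurePreserving θ P P)
    (k : ℤ) : MeasurePreserving (shift θ k) P P := by
  obtain ⟨n, rfl | rfl⟩ := k.eq_nat_or_neg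
  · rw [funext (shift_natCast θ n)]
    exact hθ.iterate n
  · rw [funext (shift_neg_natCast θ n)]
    exact (hθ.symm θ).iterate n

theorem measurable_shift (θ : Ω ≃ᵐ Ω) (k : ℤ) : Measurable (shift θ k) := by
  obtain ⟨n, rfl | rfl⟩ := k.eq_nat_or_neg
  · rw [funext (shift_natCast θ n)]
    exact θ.measurable.iterate n
  · rw [funext (shift_neg_natCast θ n)]
    exact θ.symm.measurable.iterate n

theorem shift_mem_iff {θ : Ω ≃ᵐ Ω} {S : Set Ω} (hS : θ ⁻¹' S = S) (k : ℤ) (ω : Ω) :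
    shift θ k ω ∈ S ↔ ω ∈ S := by
  have h1 : ∀ x, θ x ∈ S ↔ x ∈ S := fun x => by rw [← Set.mem_preimage, hS]
  induction k with
  | zero => rfl
  | succ n ih => rw [add_comm, shift_add, shift_one, h1]; exact ih
  | pred n ih =>
    rw [← h1, ← shift_one θ, ← shift_add, add_sub_cancel]
    exact ih

theorem productFrom_add (θ : Ω ≃ᵐ Ω) (Φ : Ω → SuperOp d) (ω : Ω) (s : ℤ) (m n : ℕ) :
    productFrom θ Φ ω s (m + n) = productFrom θ Φ ω (s + m) n ∘ₗ productFrom θ Φ ω s m := by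
  induction n with
  | zero => rfl
  | succ n ih =>
    rw [← add_assoc, productFrom, ih, productFrom, LinearMap.comp_assoc]
    push_cast
    rw [add_assoc]

theorem productFrom_shift (θ : Ω ≃ᵐ Ω) (Φ : Ω → SuperOp d) (ω : Ω) (k s : ℤ) (n : ℕ) :
    productFrom θ Φ (shift θ k ω) s n = productFrom θ Φ ω (s + k) n := by
  induction n with
  | zero => rfl
  | succ n ih =>
    rw [productFrom, ih, productFrom, ← shift_add]
    congr 3
    ring

theorem propagator_natCast_zero (θ : Ω ≃ᵐ Ω) (Φ : Ω → SuperOp d) (ω : Ω) (n : ℕ) :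
    propagator θ Φ ω n 0 = productFrom θ Φ ω 0 n := by
  simp [propagator]

theorem propagator_zero_neg (θ : Ω ≃ᵐ Ω) (Φ : Ω → SuperOp d) (ω : Ω) (n : ℕ) :
    propagator θ Φ ω 0 (-n) = productFrom θ Φ ω (-n) n := by
  simp [propagator]

theorem isPTP_productFrom {θ : Ω ≃ᵐ Ω} {Φ : Ω → SuperOp d} (hΦ : ∀ ω, IsPTP (Φ ω)) (ω : Ω)
    (s : ℤ) (n : ℕ) : IsPTP (productFrom θ Φ ω s n) := by
  induction n with
  | zero => exact IsPTP.id
  | succ n ih => exact (hΦ _).comp ih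

theorem MeasurableFamily.apply {Φ : Ω → SuperOp d} (hΦ : MeasurableFamily Φ) {Y : Ω → Mat d}
    (hY : ∀ i j, Measurable fun ω => Y ω i j) (i j : Fin d) :
    Measurable fun ω => Φ ω (Y ω) i j := by
  have h : ∀ ω, Φ ω (Y ω) i j = ∑ k, ∑ l, Y ω k l * Φ ω (Matrix.single k l 1) i j := fun ω => by
    conv_lhs => rw [Matrix.matrix_eq_sum_single (Y ω)]
    simp only [map_sum, Matrix.sum_apply]
    refine Finset.sum_congr rfl fun k _ => Finset.sum_congr rfl fun l _ => ?_
    rw [← mul_one (Y ω k l), ← smul_eq_mul, ← Matrix.smul_single, map_smul]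
    simp
  simp only [h]
  exact Finset.measurable_sum _ fun k _ => Finset.measurable_sum _ fun l _ =>
    (hY k l).mul (hΦ _ i j)

theorem MeasurableFamily.comp_measurable {Φ : Ω → SuperOp d} (hΦ : MeasurableFamily Φ)
    {g : Ω → Ω} (hg : Measurable g) : MeasurableFamily fun ω => Φ (g ω) :=
  fun X i j => (hΦ X i j).comp hg

theorem MeasurableFamily.productFrom {Φ : Ω → SuperOp d} (hΦ : MeasurableFamily Φ)
    (θ : Ω ≃ᵐ Ω) (s : ℤ) (n : ℕ) : MeasurableFamily fun ω => productFrom θ Φ ω s n := by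
  induction n with
  | zero => exact fun X i j => measurable_const
  | succ n ih =>
    exact fun X => (hΦ.comp_measurable (measurable_shift θ (s + n))).apply (ih X)

theorem measurable_traceNorm_apply {Φ : Ω → SuperOp d} (hΦ : MeasurableFamily Φ) (X : Mat d) :
    Measurable fun ω => traceNorm (Φ ω X) := by
  -- Continuity is restated for the product topology, to match entrywise measurability.
  have h0 : Continuous fun A : Fin d → Fin d → ℂ => traceNorm (Matrix.of A) :=
    continuous_traceNorm (d := d)
  have h1 := h0.measurable
  have h2 : Measurable fun ω => (fun i j => Φ ω X i j : Fin d → Fin d → ℂ) :=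
    measurable_pi_lambda _ fun i => measurable_pi_lambda _ fun j => hΦ X i j
  exact h1.comp h2

/-- The quotient is continuous on nonzero centered matrices, so a countable dense set, chosen
independently of `T`, suffices. This makes the coefficient measurable. -/
theorem exists_countable_kappaTr_eq_iSup (d : ℕ) : ∃ S : Set (centeredNonzero d), S.Countable ∧
    ∀ T : SuperOp d, kappaTr T = ⨆ X : S, traceNorm (T X) / traceNorm (X : Mat d) := by
  have : SecondCountableTopology (Mat d) :=
    inferInstanceAs (SecondCountableTopology (Fin d → Fin d → ℂ))
  obtain ⟨S, hS, hd⟩ := TopologicalSpace.exists_countable_dense (centeredNonzero d)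
  refine ⟨S, hS, fun T => (hd.ciSup' ?_).symm⟩
  refine Continuous.div ?_ (continuous_traceNorm.comp continuous_subtype_val)
    fun X => (traceNorm_pos X.2.2.2).ne'
  exact continuous_traceNorm.comp
    ((LinearMap.continuous_of_finiteDimensional T).comp continuous_subtype_val)

theorem MeasurableFamily.measurable_kappaTr {Φ : Ω → SuperOp d} (hΦ : MeasurableFamily Φ) :
    Measurable fun ω => kappaTr (Φ ω) := by
  obtain ⟨S, hS, h⟩ := exists_countable_kappaTr_eq_iSup d
  have := hS.to_subtype
  simp only [h]
  exact Measurable.iSup fun X => (measurable_traceNorm_apply hΦ _).div_const _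

theorem kappaTr_productFrom_add_le {θ : Ω ≃ᵐ Ω} {Φ : Ω → SuperOp d} (hΦ : ∀ ω, IsPTP (Φ ω))
    (ω : Ω) (s : ℤ) (m n : ℕ) :
    kappaTr (productFrom θ Φ ω s (m + n)) ≤
      kappaTr (productFrom θ Φ ω (s + m) n) * kappaTr (productFrom θ Φ ω s m) := by
  rw [productFrom_add]
  exact (isPTP_productFrom hΦ _ _ _).kappaTr_comp_le (isPTP_productFrom hΦ _ _ _)

/-- If contracting blocks of length `N` start at every time where `a` does not vanish, then the
cocycle contracts exponentially in the number of such times. -/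
theorem kappaTr_productFrom_le_exp {θ : Ω ≃ᵐ Ω} {Φ : Ω → SuperOp d} (hΦ : ∀ ω, IsPTP (Φ ω))
    (ω : Ω) {N : ℕ} (hN : 0 < N) {t : ℝ} (ht : 0 ≤ t) {a : ℤ → ℝ} (ha : ∀ k, a k ≤ 1)
    (h : ∀ s, a s = 0 ∨ kappaTr (productFrom θ Φ ω s N) ≤ Real.exp (-t)) (n : ℕ) :
    ∀ s : ℤ, kappaTr (productFrom θ Φ ω s n) ≤
      Real.exp (t - t / N * ∑ i ∈ Finset.range n, a (s + i)) := by
  have hN0 : (0 : ℝ) < N := by exact_mod_cast hN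
  have htN : t / N * N = t := div_mul_cancel₀ t hN0.ne'
  have htN0 : 0 ≤ t / N := by positivity
  have hsum : ∀ (m : ℕ) (s : ℤ), ∑ i ∈ Finset.range m, a (s + i) ≤ m := fun m s =>
    (Finset.sum_le_card_nsmul _ _ 1 fun _ _ => ha _).trans (by simp)
  have split : ∀ m n : ℕ, ∀ s : ℤ, ∑ i ∈ Finset.range (m + n), a (s + i) =
      ∑ i ∈ Finset.range m, a (s + i) + ∑ i ∈ Finset.range n, a (s + m + i) := by
    intro m n s
    rw [Finset.sum_range_add]
    push_cast
    simp only [add_assoc]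
  induction n using Nat.strong_induction_on with
  | _ n ih =>
    intro s
    -- The prefactor `exp t` covers an incomplete last block: it contains at most `N` visits, each
    -- worth `t / N`.
    by_cases hn : n < N
    · refine (isPTP_productFrom hΦ _ _ _).kappaTr_le_one.trans (Real.one_le_exp ?_)
      have h1 : (n : ℝ) ≤ N := by exact_mod_cast hn.le
      have := mul_le_mul_of_nonneg_left ((hsum n s).trans h1) htN0
      linarith
    -- Greedy choice: move one step where `a` vanishes, otherwise use a whole contracting block,
    -- which gains `t` and skips at most `N` visits.
    rcases h s with h0 | h1
    · obtain ⟨k, rfl⟩ : ∃ k, n = 1 + k := ⟨n - 1, by omega⟩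
      refine (kappaTr_productFrom_add_le hΦ ω s 1 k).trans ?_
      refine (mul_le_of_le_one_right (kappaTr_nonneg _)
        (isPTP_productFrom hΦ _ _ _).kappaTr_le_one).trans ?_
      refine (ih k (by omega) _).trans (le_of_eq ?_)
      rw [split 1 k s]
      simp [h0]
    · obtain ⟨k, rfl⟩ : ∃ k, n = N + k := ⟨n - N, by omega⟩
      refine (kappaTr_productFrom_add_le hΦ ω s N k).trans ?_
      refine (mul_le_mul (ih k (by omega) _) h1 (kappaTr_nonneg _) (Real.exp_nonneg _)).trans ?_
      rw [← Real.exp_add, Real.exp_le_exp, split N k s]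
      have := mul_le_mul_of_nonneg_left (hsum N s) htN0
      linarith

/-- The points where the product of the first `N + 1` channels contracts by `exp (-1 / (N + 1))`. -/
def contractingSet (θ : Ω ≃ᵐ Ω) (Φ : Ω → SuperOp d) (N : ℕ) : Set Ω :=
  {ω | kappaTr (productFrom θ Φ ω 0 (N + 1)) ≤ Real.exp (-(1 / (N + 1)))}

theorem measurableSet_contractingSet (θ : Ω ≃ᵐ Ω) {Φ : Ω → SuperOp d} (hΦ : MeasurableFamily Φ)
    (N : ℕ) : MeasurableSet (contractingSet θ Φ N) :=
  measurableSet_le (hΦ.productFrom θ 0 (N + 1)).measurable_kappaTr measurable_const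

theorem exists_kappaTr_lt_one {θ : Ω ≃ᵐ Ω} {Φ : Ω → SuperOp d} {ω : Ω}
    (h : lyapunovExponent θ Φ ω < 0) : ∃ n, 1 ≤ n ∧ kappaTr (productFrom θ Φ ω 0 n) < 1 := by
  obtain ⟨n, hn, hn1⟩ := ((eventually_lt_of_limsup_lt h).and (eventually_ge_atTop 1)).exists
  refine ⟨n, hn1, ?_⟩
  by_contra! hk
  refine hn.not_ge ?_
  rw [logRate, propagator_natCast_zero]
  refine EReal.div_nonneg ?_ (by exact_mod_cast Nat.zero_le n)
  rw [← ENNReal.log_one]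
  exact ENNReal.log_monotone (ENNReal.one_le_ofReal.2 hk)

/-- The coefficient does not increase with the length of the product, while the thresholds `exp (-1
/ (N + 1))` tend to `1`; a single value below `1` is therefore enough. -/
theorem exists_mem_contractingSet {θ : Ω ≃ᵐ Ω} {Φ : Ω → SuperOp d} (hΦ : ∀ ω, IsPTP (Φ ω))
    {ω : Ω} (h : lyapunovExponent θ Φ ω < 0) : ∃ N, ω ∈ contractingSet θ Φ N := by
  obtain ⟨n, hn, hk⟩ := exists_kappaTr_lt_one h
  have hlim : Tendsto (fun N : ℕ => Real.exp (-(1 / ((N : ℝ) + 1)))) atTop (𝓝 1) := by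
    have := (Real.continuous_exp.tendsto _).comp
      (tendsto_one_div_add_atTop_nhds_zero_nat (𝕜 := ℝ)).neg
    simpa [Function.comp_def] using this
  obtain ⟨N, hN, hNn⟩ := ((hlim.eventually (lt_mem_nhds hk)).and (eventually_ge_atTop n)).exists
  refine ⟨N, ?_⟩
  obtain ⟨k, hk⟩ : ∃ k, N + 1 = n + k := ⟨N + 1 - n, by omega⟩
  rw [contractingSet, Set.mem_ofPred_eq, hk]
  refine (kappaTr_productFrom_add_le hΦ ω 0 n k).trans (le_trans ?_ hN.le)
  exact mul_le_of_le_one_left (kappaTr_nonneg _) (isPTP_productFrom hΦ _ _ _).kappaTr_le_one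

/-- The smaller of the lower densities of the visits to the contracting set along the forward and
the backward orbit. -/
noncomputable def contractionDensity (θ : Ω ≃ᵐ Ω) (Φ : Ω → SuperOp d) (N : ℕ) (ω : Ω) : ℝ :=
  min (lowerDensity θ (contractingSet θ Φ N) ω) (lowerDensity θ.symm (contractingSet θ Φ N) ω)

/-- The guaranteed exponential contraction speed. -/
noncomputable def contractionSpeed (θ : Ω ≃ᵐ Ω) (Φ : Ω → SuperOp d) (ω : Ω) : ℝ :=
  ⨆ N : ℕ, 1 / ((N : ℝ) + 1) / (N + 1) * contractionDensity θ Φ N ω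

theorem contractionDensity_apply (θ : Ω ≃ᵐ Ω) (Φ : Ω → SuperOp d) (N : ℕ) (ω : Ω) :
    contractionDensity θ Φ N (θ ω) = contractionDensity θ Φ N ω := by
  rw [contractionDensity, contractionDensity, lowerDensity_apply,
    ← lowerDensity_apply θ.symm _ (θ ω), θ.symm_apply_apply]

theorem contractionSpeed_apply (θ : Ω ≃ᵐ Ω) (Φ : Ω → SuperOp d) (ω : Ω) :
    contractionSpeed θ Φ (θ ω) = contractionSpeed θ Φ ω := by
  simp only [contractionSpeed, contractionDensity_apply]

theorem measurable_contractionSpeed (θ : Ω ≃ᵐ Ω) {Φ : Ω → SuperOp d} (hΦ : MeasurableFamily Φ) :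
    Measurable (contractionSpeed θ Φ) :=
  Measurable.iSup fun N => Measurable.const_mul
    ((measurable_lowerDensity θ.measurable (measurableSet_contractingSet θ hΦ N)).min
      (measurable_lowerDensity θ.symm.measurable (measurableSet_contractingSet θ hΦ N))) _

theorem bddAbove_contractionSpeed (θ : Ω ≃ᵐ Ω) (Φ : Ω → SuperOp d) (ω : Ω) :
    BddAbove (Set.range fun N : ℕ =>
      1 / ((N : ℝ) + 1) / (N + 1) * contractionDensity θ Φ N ω) := by
  refine ⟨1, ?_⟩
  rintro _ ⟨N, rfl⟩
  have hN : (1 : ℝ) ≤ N + 1 := by linarith [Nat.cast_nonneg (α := ℝ) N]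
  refine mul_le_one₀ ?_ (le_min (lowerDensity_nonneg _ _ _) (lowerDensity_nonneg _ _ _))
    ((min_le_left _ _).trans (lowerDensity_le_one _ _ _))
  exact div_le_one_of_le₀ ((div_le_one_of_le₀ hN (by positivity)).trans hN) (by positivity)

theorem ae_contractionSpeed_pos {P : Measure Ω} [IsProbabilityMeasure P] {θ : Ω ≃ᵐ Ω}
    (hθ : MeasurePreserving θ P P) {Φ : Ω → SuperOp d} (hΦm : MeasurableFamily Φ)
    (hΦ : ∀ ω, IsPTP (Φ ω)) (hneg : ∀ᵐ ω ∂P, lyapunovExponent θ Φ ω < 0) :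
    ∀ᵐ ω ∂P, 0 < contractionSpeed θ Φ ω := by
  have h1 := ae_all_iff.2 fun N =>
    ae_lowerDensity_pos hθ (measurableSet_contractingSet θ hΦm N)
  have h2 := ae_all_iff.2 fun N =>
    ae_lowerDensity_pos (hθ.symm θ) (measurableSet_contractingSet θ hΦm N)
  filter_upwards [hneg, h1, h2] with ω h0 h1 h2
  obtain ⟨N, hN⟩ := exists_mem_contractingSet hΦ h0
  refine lt_of_lt_of_le (mul_pos (by positivity) (lt_min (h1 N hN) (h2 N hN)))
    (le_ciSup (bddAbove_contractionSpeed θ Φ ω) N)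

/-- Each block has length `N + 1` and gains `1 / (N + 1)`, hence the double division in the weight
of a visit. -/
theorem kappaTr_productFrom_le_exp_indicator {θ : Ω ≃ᵐ Ω} {Φ : Ω → SuperOp d}
    (hΦ : ∀ ω, IsPTP (Φ ω)) (ω : Ω) (N n : ℕ) (s : ℤ) :
    kappaTr (productFrom θ Φ ω s n) ≤ Real.exp (1 / ((N : ℝ) + 1) - 1 / ((N : ℝ) + 1) / (N + 1) *
      ∑ i ∈ Finset.range n, (contractingSet θ Φ N).indicator 1 (shift θ (s + i) ω)) := by
  have := kappaTr_productFrom_le_exp (θ := θ) hΦ ω N.succ_pos (t := 1 / ((N : ℝ) + 1)) (by positivity)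
    (a := fun k => (contractingSet θ Φ N).indicator 1 (shift θ k ω))
    (fun k => Set.indicator_apply_le' (fun _ => le_rfl) fun _ => zero_le_one)
    (fun s => ?_) n s
  · simpa using this
  · by_cases hs : shift θ s ω ∈ contractingSet θ Φ N
    · right
      rw [contractingSet, Set.mem_ofPred_eq, productFrom_shift, zero_add] at hs
      exact hs
    · left
      exact Set.indicator_of_notMem hs _

theorem sum_shift_zero {θ : Ω ≃ᵐ Ω} (g : Ω → ℝ) (n : ℕ) (ω : Ω) :
    ∑ i ∈ Finset.range n, g (shift θ (0 + i) ω) = birkhoffSum θ g n ω := by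
  simp only [zero_add, shift_natCast, birkhoffSum]

/-- The window covers times `-n` to `-1`. Read backwards, it is an orbit of `θ.symm` starting at
`θ.symm ω`, not at `ω`. -/
theorem sum_shift_neg {θ : Ω ≃ᵐ Ω} (g : Ω → ℝ) (n : ℕ) (ω : Ω) :
    ∑ i ∈ Finset.range n, g (shift θ (-n + i) ω) = birkhoffSum θ.symm g n (θ.symm ω) := by
  rw [birkhoffSum, ← Finset.sum_range_reflect]
  refine Finset.sum_congr rfl fun i hi => ?_
  rw [Finset.mem_range] at hi
  rw [← Function.iterate_succ_apply, ← shift_neg_natCast]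
  congr 2
  omega

theorem eventually_kappaTr_le {θ : Ω ≃ᵐ Ω} {Φ : Ω → SuperOp d} (hΦ : ∀ ω, IsPTP (Φ ω)) {ω : Ω}
    {b : ℝ} (hb : b < contractionSpeed θ Φ ω) :
    ∃ C, ∀ᶠ n : ℕ in atTop, kappaTr (productFrom θ Φ ω 0 n) * Real.exp (b * n) ≤ C ∧
      kappaTr (productFrom θ Φ ω (-n) n) * Real.exp (b * n) ≤ C := by
  obtain ⟨N, hN⟩ := exists_lt_of_lt_ciSup hb
  have hc : 0 < 1 / ((N : ℝ) + 1) / (N + 1) := by positivity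
  rw [← div_lt_iff₀' hc] at hN
  have h1 := eventually_lt_birkhoffSum_of_lt_lowerDensity (hN.trans_le (min_le_left _ _))
  have h2 := hN.trans_le (min_le_right _ _)
  -- Invariance moves the base point to `θ.symm ω`, where the backward window starts.
  rw [← lowerDensity_apply] at h2
  have h2 := eventually_lt_birkhoffSum_of_lt_lowerDensity h2
  have key : ∀ (s : ℤ) (n : ℕ), b / (1 / ((N : ℝ) + 1) / (N + 1)) * n ≤ ∑ i ∈ Finset.range n,
      (contractingSet θ Φ N).indicator (1 : Ω → ℝ) (shift θ (s + i) ω) →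
      kappaTr (productFrom θ Φ ω s n) * Real.exp (b * n) ≤ Real.exp (1 / ((N : ℝ) + 1)) := by
    intro s n h
    refine (mul_le_mul_of_nonneg_right (kappaTr_productFrom_le_exp_indicator hΦ ω N n s)
      (Real.exp_nonneg _)).trans ?_
    rw [← Real.exp_add, Real.exp_le_exp]
    have h3 := mul_le_mul_of_nonneg_left h hc.le
    rw [← mul_assoc, mul_div_cancel₀ _ hc.ne'] at h3
    linarith
  refine ⟨Real.exp (1 / ((N : ℝ) + 1)), ?_⟩
  filter_upwards [h1, h2] with n h1 h2
  exact ⟨key 0 n (by rwa [sum_shift_zero]), key (-n) n (by rwa [sum_shift_neg])⟩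

end Cocycle

end QuantumCocycle

/-! ### The pullback state and the rate constants. -/

namespace QuantumCocycle

section StationaryState

open MeasureTheory Filter Topology

variable {Ω : Type*} [MeasurableSpace Ω] {d : ℕ}

/-- The maximally mixed state. -/
noncomputable def mixedState (d : ℕ) : Mat d := (d : ℂ)⁻¹ • 1

open scoped ComplexOrder in
theorem mixedState_mem (hd : 1 ≤ d) : mixedState d ∈ stateSpace d := by
  have hd0 : (d : ℂ) ≠ 0 := by exact_mod_cast (by omega : d ≠ 0)
  refine ⟨Matrix.PosSemidef.one.smul ?_, ?_⟩
  · rw [← Complex.ofReal_natCast, ← Complex.ofReal_inv]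
    exact Complex.zero_le_real.2 (inv_nonneg.2 (Nat.cast_nonneg d))
  · simp [mixedState, Matrix.trace_smul, hd0]

open scoped Matrix.Norms.L2Operator in
/-- If the past contracts, then all states from the remote past converge to a common limit. -/
theorem exists_pullback_limit (hd : 1 ≤ d) {θ : Ω ≃ᵐ Ω} {Φ : Ω → SuperOp d}
    (hΦ : ∀ ω, IsPTP (Φ ω)) {ω : Ω}
    (h : Tendsto (fun n : ℕ => kappaTr (productFrom θ Φ ω (-n) n)) atTop (𝓝 0)) :
    ∃ τ ∈ stateSpace d, ∀ σ : ℕ → Mat d, (∀ n, σ n ∈ stateSpace d) →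
      Tendsto (fun n : ℕ => productFrom θ Φ ω (-n) n (σ n)) atTop (𝓝 τ) := by
  have h2 : Tendsto (fun n : ℕ => 2 * kappaTr (productFrom θ Φ ω (-n) n)) atTop (𝓝 0) := by
    simpa using h.const_mul 2
  have hmem : ∀ (s : ℤ) (n : ℕ), productFrom θ Φ ω s n (mixedState d) ∈ stateSpace d :=
    fun s n => (isPTP_productFrom hΦ _ _ _).map_stateSpace (mixedState_mem hd)
  have hdist : ∀ n : ℕ, ∀ σ ∈ stateSpace d, ∀ σ' ∈ stateSpace d,
      ‖productFrom θ Φ ω (-n) n σ - productFrom θ Φ ω (-n) n σ'‖ ≤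
        2 * kappaTr (productFrom θ Φ ω (-n) n) := fun n σ hσ σ' hσ' =>
    (norm_le_traceNorm _).trans ((isPTP_productFrom hΦ _ _ _).traceNorm_sub_state_le hσ hσ')
  have hc : CauchySeq fun n : ℕ => productFrom θ Φ ω (-n) n (mixedState d) := by
    refine cauchySeq_of_le_tendsto_0' _ (fun n m hnm => ?_) h2
    obtain ⟨k, rfl⟩ := Nat.exists_eq_add_of_le' hnm
    -- Starting further in the past only changes the state fed into the last `n` channels.
    have : productFrom θ Φ ω (-(k + n : ℕ)) (k + n) (mixedState d) =
        productFrom θ Φ ω (-n) n (productFrom θ Φ ω (-(k + n : ℕ)) k (mixedState d)) := by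
      rw [productFrom_add, LinearMap.comp_apply]
      congr 2
      push_cast
      ring
    rw [this, dist_eq_norm]
    exact hdist n _ (mixedState_mem hd) _ (hmem _ _)
  have : CompleteSpace (Mat d) := FiniteDimensional.complete ℂ _
  obtain ⟨τ, hτ⟩ := cauchySeq_tendsto_of_complete hc
  refine ⟨τ, isClosed_stateSpace.mem_of_tendsto hτ (Eventually.of_forall fun n => hmem _ _),
    fun σ hσ => ?_⟩
  have h3 : Tendsto (fun n : ℕ => productFrom θ Φ ω (-n) n (σ n) -
      productFrom θ Φ ω (-n) n (mixedState d)) atTop (𝓝 0) :=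
    squeeze_zero_norm (fun n => hdist n _ (hσ n) _ (mixedState_mem hd)) h2
  simpa using h3.add hτ

open Classical in
/-- The common limit of all states from the remote past, where it exists. -/
noncomputable def pullbackState (θ : Ω ≃ᵐ Ω) (Φ : Ω → SuperOp d) (ω : Ω) : Mat d :=
  if h : ∃ τ ∈ stateSpace d, ∀ σ : ℕ → Mat d, (∀ n, σ n ∈ stateSpace d) →
      Tendsto (fun n : ℕ => productFrom θ Φ ω (-n) n (σ n)) atTop (𝓝 τ) then h.choose
  else mixedState d

theorem pullbackState_mem (hd : 1 ≤ d) (θ : Ω ≃ᵐ Ω) (Φ : Ω → SuperOp d) (ω : Ω) :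
    pullbackState θ Φ ω ∈ stateSpace d := by
  rw [pullbackState]
  split_ifs with h
  exacts [h.choose_spec.1, mixedState_mem hd]

theorem tendsto_pullbackState (hd : 1 ≤ d) {θ : Ω ≃ᵐ Ω} {Φ : Ω → SuperOp d}
    (hΦ : ∀ ω, IsPTP (Φ ω)) {ω : Ω}
    (h : Tendsto (fun n : ℕ => kappaTr (productFrom θ Φ ω (-n) n)) atTop (𝓝 0))
    {σ : ℕ → Mat d} (hσ : ∀ n, σ n ∈ stateSpace d) :
    Tendsto (fun n : ℕ => productFrom θ Φ ω (-n) n (σ n)) atTop (𝓝 (pullbackState θ Φ ω)) := by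
  have h' := exists_pullback_limit hd hΦ h
  rw [pullbackState, dif_pos h']
  exact h'.choose_spec.2 σ hσ

/-- The length `n + 1` pullback at `θ ω` is `Φ ω` after the length `n` pullback at `ω`; continuity
of `Φ ω` gives the limit. -/
theorem apply_pullbackState (hd : 1 ≤ d) {θ : Ω ≃ᵐ Ω} {Φ : Ω → SuperOp d}
    (hΦ : ∀ ω, IsPTP (Φ ω)) {ω : Ω}
    (h : Tendsto (fun n : ℕ => kappaTr (productFrom θ Φ ω (-n) n)) atTop (𝓝 0))
    (h' : Tendsto (fun n : ℕ => kappaTr (productFrom θ Φ (θ ω) (-n) n)) atTop (𝓝 0)) :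
    Φ ω (pullbackState θ Φ ω) = pullbackState θ Φ (θ ω) := by
  have h1 := ((LinearMap.continuous_of_finiteDimensional (Φ ω)).tendsto _).comp
    (tendsto_pullbackState hd hΦ h fun _ => mixedState_mem hd)
  have h2 := (tendsto_add_atTop_iff_nat 1).2
    (tendsto_pullbackState hd hΦ h' fun _ => mixedState_mem hd)
  refine tendsto_nhds_unique h1 (h2.congr fun n => ?_)
  rw [← shift_one θ, productFrom_shift, Function.comp_apply]
  have : -((n + 1 : ℕ) : ℤ) + 1 = -n := by push_cast; ring
  rw [this, productFrom, LinearMap.comp_apply, neg_add_cancel, shift_zero]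

theorem productFrom_apply_of_stationary {θ : Ω ≃ᵐ Ω} {Φ : Ω → SuperOp d} {η : Ω → Mat d} {ω : Ω}
    (h : ∀ k : ℤ, Φ (shift θ k ω) (η (shift θ k ω)) = η (θ (shift θ k ω))) (s : ℤ) (n : ℕ) :
    productFrom θ Φ ω s n (η (shift θ s ω)) = η (shift θ (s + n) ω) := by
  induction n with
  | zero => simp [productFrom]
  | succ n ih =>
    rw [productFrom, LinearMap.comp_apply, ih, h, ← shift_one θ, ← shift_add]
    congr 2
    push_cast
    ring

/-- The forward rate constant at exponent `b`. -/
noncomputable def forwardConstant (θ : Ω ≃ᵐ Ω) (Φ : Ω → SuperOp d) (b : Ω → ℝ) (ω : Ω) : ℝ :=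
  ⨆ n : ℕ, kappaTr (productFrom θ Φ ω 0 n) * Real.exp (-b ω * n)

/-- The backward rate constant at exponent `b`. -/
noncomputable def backwardConstant (θ : Ω ≃ᵐ Ω) (Φ : Ω → SuperOp d) (b : Ω → ℝ) (ω : Ω) : ℝ :=
  ⨆ n : ℕ, kappaTr (productFrom θ Φ ω (-n) n) * Real.exp (-b ω * n)

theorem measurable_forwardConstant (θ : Ω ≃ᵐ Ω) {Φ : Ω → SuperOp d} (hΦ : MeasurableFamily Φ)
    {b : Ω → ℝ} (hb : Measurable b) : Measurable (forwardConstant θ Φ b) :=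
  Measurable.iSup fun n => (hΦ.productFrom θ _ n).measurable_kappaTr.mul
    (Real.measurable_exp.comp (hb.neg.mul_const _))

theorem measurable_backwardConstant (θ : Ω ≃ᵐ Ω) {Φ : Ω → SuperOp d} (hΦ : MeasurableFamily Φ)
    {b : Ω → ℝ} (hb : Measurable b) : Measurable (backwardConstant θ Φ b) :=
  Measurable.iSup fun n => (hΦ.productFrom θ _ n).measurable_kappaTr.mul
    (Real.measurable_exp.comp (hb.neg.mul_const _))

theorem kappaTr_le_rateConstants {θ : Ω ≃ᵐ Ω} {Φ : Ω → SuperOp d} (hΦ : ∀ ω, IsPTP (Φ ω))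
    {b : Ω → ℝ} {ω : Ω} (hb : -b ω < contractionSpeed θ Φ ω) (n : ℕ) :
    kappaTr (productFrom θ Φ ω 0 n) ≤ forwardConstant θ Φ b ω * Real.exp (b ω * n) ∧
      kappaTr (productFrom θ Φ ω (-n) n) ≤ backwardConstant θ Φ b ω * Real.exp (b ω * n) := by
  obtain ⟨C, hC⟩ := eventually_kappaTr_le hΦ hb
  have key : ∀ u : ℕ → ℝ, (∀ᶠ n : ℕ in atTop, u n * Real.exp (-b ω * n) ≤ C) →
      u n ≤ (⨆ n : ℕ, u n * Real.exp (-b ω * n)) * Real.exp (b ω * n) := by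
    intro u hu
    have hbdd : BddAbove (Set.range fun n : ℕ => u n * Real.exp (-b ω * n)) :=
      -- An eventual bound on a sequence bounds its whole range, so the real supremum is genuine
      -- here rather than the default `0`.
      Filter.IsBoundedUnder.bddAbove_range ⟨C, eventually_map.2 hu⟩
    refine le_trans (le_of_eq ?_) (mul_le_mul_of_nonneg_right (le_ciSup hbdd n) (Real.exp_nonneg _))
    rw [mul_assoc, ← Real.exp_add, neg_mul, neg_add_cancel, Real.exp_zero, mul_one]
  exact ⟨key _ (hC.mono fun _ h => h.1), key _ (hC.mono fun _ h => h.2)⟩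

theorem tendsto_kappaTr_backward {θ : Ω ≃ᵐ Ω} {Φ : Ω → SuperOp d} (hΦ : ∀ ω, IsPTP (Φ ω))
    {ω : Ω} (h : 0 < contractionSpeed θ Φ ω) :
    Tendsto (fun n : ℕ => kappaTr (productFrom θ Φ ω (-n) n)) atTop (𝓝 0) := by
  have hb : -(-(contractionSpeed θ Φ ω / 2)) < contractionSpeed θ Φ ω := by linarith
  refine squeeze_zero (fun _ => kappaTr_nonneg _)
    (fun n => (kappaTr_le_rateConstants hΦ (b := fun _ => -(contractionSpeed θ Φ ω / 2)) hb n).2) ?_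
  have h1 : Tendsto (fun n : ℕ => -(contractionSpeed θ Φ ω / 2) * (n : ℝ)) atTop atBot :=
    tendsto_natCast_atTop_atTop.const_mul_atTop_of_neg (by linarith)
  simpa using (Real.tendsto_exp_atBot.comp h1).const_mul
    (backwardConstant θ Φ (fun _ => -(contractionSpeed θ Φ ω / 2)) ω)

theorem measurable_pullbackState (hd : 1 ≤ d) (θ : Ω ≃ᵐ Ω) {Φ : Ω → SuperOp d}
    (hΦm : MeasurableFamily Φ) (hΦ : ∀ ω, IsPTP (Φ ω)) {S : Set Ω} (hS : MeasurableSet S)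
    (h : ∀ ω ∈ S, Tendsto (fun n : ℕ => kappaTr (productFrom θ Φ ω (-n) n)) atTop (𝓝 0))
    (i j : Fin d) : Measurable (S.indicator fun ω => pullbackState θ Φ ω i j) := by
  refine measurable_of_tendsto_metrizable
    (f := fun n : ℕ => S.indicator fun ω => productFrom θ Φ ω (-n) n (mixedState d) i j)
    (fun n => (hΦm.productFrom θ _ n (mixedState d) i j).indicator hS) ?_
  refine tendsto_pi_nhds.2 fun ω => ?_
  by_cases hω : ω ∈ S
  · simp only [Set.indicator_of_mem hω]
    have := tendsto_pullbackState hd hΦ (h ω hω) fun _ => mixedState_mem hd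
    exact tendsto_pi_nhds.1 (tendsto_pi_nhds.1 this i) j
  · simp only [Set.indicator_of_notMem hω]
    exact tendsto_const_nhds

end StationaryState

end QuantumCocycle

/-! ### Assembly of the theorem. -/

open MeasureTheory QuantumCocycle in
theorem mainTheorem1 {Ω : Type*} [MeasurableSpace Ω] (P : Measure Ω) [IsProbabilityMeasure P]
    (θ : Ω ≃ᵐ Ω) (hθ : MeasurePreserving θ P P)
    (d : ℕ) (hd : 1 ≤ d) (Φ : Ω → SuperOp d)
    (hΦ_meas : MeasurableFamily Φ) (hΦ : ∀ ω, IsCPTP (Φ ω))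
    (hneg : ∀ᵐ ω ∂P, lyapunovExponent θ Φ ω < 0) :
    ∃ ρ : Ω → Mat d,
      IsStationaryState P θ Φ ρ ∧
      (∀ η : Ω → Mat d, IsStationaryState P θ Φ η → ∀ᵐ ω ∂P, η ω = ρ ω) ∧
      ∃ β : Ω → ℝ, Measurable β ∧ (∀ ω, β ω < 0) ∧ (∀ ω, β (θ ω) = β ω) ∧
      ∃ Ωs : Set Ω, MeasurableSet Ωs ∧ θ ⁻¹' Ωs = Ωs ∧ P Ωs = 1 ∧
      ∃ Cp Cm : Ω → ℝ, Measurable Cp ∧ Measurable Cm ∧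
        ∀ ω ∈ Ωs, ∀ n : ℕ, 1 ≤ n →
          oneToOneNorm (propagator θ Φ ω n 0 - replacement (ρ (shift θ n ω)))
            ≤ 4 * Cp ω * Real.exp (β ω * n) ∧
          oneToOneNorm (propagator θ Φ ω 0 (-n) - replacement (ρ ω))
            ≤ 4 * Cm ω * Real.exp (β ω * n) ∧
          (∀ σ ∈ stateSpace d,
            traceNorm (propagator θ Φ ω n 0 σ - ρ (shift θ n ω))
              ≤ 2 * Cp ω * Real.exp (β ω * n)) ∧
          (∀ σ ∈ stateSpace d,
            traceNorm (propagator θ Φ ω 0 (-n) σ - ρ ω)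
              ≤ 2 * Cm ω * Real.exp (β ω * n)) := by
  classical
  have hP : ∀ ω, IsPTP (Φ ω) := fun ω => (hΦ ω).isPTP
  have hsm := measurable_contractionSpeed θ hΦ_meas
  set S : Set Ω := {ω | 0 < contractionSpeed θ Φ ω} with hS
  have hSm : MeasurableSet S := measurableSet_lt measurable_const hsm
  have hSθ : θ ⁻¹' S = S := by
    ext ω
    simp only [hS, Set.mem_preimage, Set.mem_ofPred_eq, contractionSpeed_apply]
  have hSP : ∀ᵐ ω ∂P, ω ∈ S := ae_contractionSpeed_pos hθ hΦ_meas hP hneg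
  have hlim : ∀ ω ∈ S, _ := fun ω hω => tendsto_kappaTr_backward hP (ω := ω) hω
  -- Off the good set a fixed state keeps `ρ` measurable and state-valued everywhere.
  set ρ : Ω → Mat d := fun ω => if ω ∈ S then pullbackState θ Φ ω else mixedState d
  have hρS : ∀ ω ∈ S, ρ ω = pullbackState θ Φ ω := fun ω hω => if_pos hω
  have hρ : ∀ ω, ρ ω ∈ stateSpace d := fun ω => by
    by_cases hω : ω ∈ S
    · rw [hρS ω hω]
      exact pullbackState_mem hd θ Φ ω
    · simp only [ρ, if_neg hω]
      exact mixedState_mem hd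
  have hstat : ∀ ω ∈ S, Φ ω (ρ ω) = ρ (θ ω) := fun ω hω => by
    have hθω : θ ω ∈ S := by rwa [← Set.mem_preimage, hSθ]
    rw [hρS ω hω, hρS _ hθω]
    exact apply_pullbackState hd hP (hlim ω hω) (hlim _ hθω)
  refine ⟨ρ, ⟨hρ, fun i j => ?_, hSP.mono hstat⟩, fun η hη => ?_, ?_⟩
  · have h : Measurable fun ω => if ω ∈ S then S.indicator (fun ω => pullbackState θ Φ ω i j) ω
        else mixedState d i j :=
      Measurable.ite hSm (measurable_pullbackState hd θ hΦ_meas hP hSm hlim i j) measurable_const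
    convert h using 2 with ω
    by_cases hω : ω ∈ S <;> simp [ρ, hω]
  -- Countably many null sets are discarded, so that `η` is stationary along the entire two-sided
  -- orbit. The initial state at time `-n` is then `η` itself, which is why the limit must allow
  -- states varying with `n`.
  · have h := ae_all_iff.2 fun k : ℤ =>
      (measurePreserving_shift hθ k).quasiMeasurePreserving.ae hη.stationary
    filter_upwards [h, hSP] with ω h hω
    have h1 := tendsto_pullbackState hd hP (hlim ω hω)
      (σ := fun n => η (shift θ (-n) ω)) fun n => hη.mem_stateSpace _
    simp only [productFrom_apply_of_stationary h, neg_add_cancel, shift_zero] at h1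
    rw [hρS ω hω]
    exact tendsto_nhds_unique tendsto_const_nhds h1
  -- Halving the speed gives a rate strictly below it, as finiteness of the constants requires; `-1`
  -- only keeps `β` negative off `S`.
  set β : Ω → ℝ := fun ω => if ω ∈ S then -(contractionSpeed θ Φ ω / 2) else -1
  have hβS : ∀ ω ∈ S, β ω = -(contractionSpeed θ Φ ω / 2) := fun ω hω => if_pos hω
  have hβm : Measurable β := Measurable.ite hSm (hsm.div_const 2).neg measurable_const
  refine ⟨β, hβm, fun ω => ?_, fun ω => ?_, S, hSm, hSθ, (prob_compl_eq_zero_iff hSm).1 hSP,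
    fun ω => d ^ 2 * forwardConstant θ Φ β ω, fun ω => d ^ 2 * backwardConstant θ Φ β ω,
    (measurable_forwardConstant θ hΦ_meas hβm).const_mul _,
    (measurable_backwardConstant θ hΦ_meas hβm).const_mul _, fun ω hω n _ => ?_⟩
  · by_cases hω : ω ∈ S
    · rw [hβS ω hω]
      have : 0 < contractionSpeed θ Φ ω := hω
      linarith
    · simp [β, hω]
  · have h : θ ω ∈ S ↔ ω ∈ S := by rw [← Set.mem_preimage, hSθ]
    simp only [β, h, contractionSpeed_apply]
  have hrate := kappaTr_le_rateConstants (θ := θ) hP (b := β) (ω := ω)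
    (by linarith [hβS ω hω, show 0 < contractionSpeed θ Φ ω from hω]) n
  have horbit : ∀ (s : ℤ) (m : ℕ),
      productFrom θ Φ ω s m (ρ (shift θ s ω)) = ρ (shift θ (s + m) ω) :=
    productFrom_apply_of_stationary fun k => hstat _ ((shift_mem_iff hSθ k ω).2 hω)
  have bounds : ∀ (s : ℤ) (C : ℝ), kappaTr (productFrom θ Φ ω s n) ≤ C * Real.exp (β ω * n) →
      oneToOneNorm (productFrom θ Φ ω s n - replacement (ρ (shift θ (s + n) ω))) ≤
        4 * (d ^ 2 * C) * Real.exp (β ω * n) ∧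
      ∀ σ ∈ stateSpace d, traceNorm (productFrom θ Φ ω s n σ - ρ (shift θ (s + n) ω)) ≤
        2 * (d ^ 2 * C) * Real.exp (β ω * n) := by
    intro s C hC
    have hT := isPTP_productFrom (θ := θ) hP ω s n
    -- The bound on states needs no `d ^ 2`; it is weakened so that both bounds share one constant.
    have hd1 : (1 : ℝ) ≤ (d : ℝ) ^ 2 := one_le_pow₀ (by exact_mod_cast hd)
    have hC' := mul_le_mul_of_nonneg_left hC (zero_le_one.trans hd1)
    rw [← horbit]
    refine ⟨(hT.oneToOneNorm_sub_replacement_le (hρ _)).trans (by linarith), fun σ hσ => ?_⟩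
    refine (hT.traceNorm_sub_state_le hσ (hρ _)).trans ?_
    have := le_mul_of_one_le_left (kappaTr_nonneg (productFrom θ Φ ω s n)) hd1
    linarith
  have hf := bounds 0 _ hrate.1
  have hb := bounds (-n) _ hrate.2
  rw [zero_add, ← propagator_natCast_zero] at hf
  rw [neg_add_cancel, shift_zero, ← propagator_zero_neg] at hb
  exact ⟨hf.1, hb.1, hf.2, hb.2⟩
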